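/- Let $(X,\tau)$ be a Polish space with its Borel $\sigma$-algebra, and let $\mathsf d:X\times X\to[0,\infty]$ be an extended metric such that $(X,\tau,\mathsf d)$ is an extended metric-topological space: $\tau$ is generated by the bounded, $\tau$-continuous, $\mathsf d$-Lipschitz functions $f:X\to\mathbb R$, and $\mathsf d(x,y)=\sup|f(x)-f(y)|$, where the supremum runs over those $f$ of them that are $1$-Lipschitz for $\mathsf d$. For $n\ge 1$ and weights $\lambda_1,\dots,\lambda_n>0$ with $\sum_i\lambda_i=1$ put $c_\lambda(x_1,\dots,x_n)=\inf_{y\in X}\sum_i\lambda_i\mathsf d^2(x_i,y)\in[0,\infty]$. Assume that either $\tau$ is the topology induced by $\mathsf d$, or all the costs $c_\lambda:X^n\to[0,\infty]$ are lower semicontinuous. Let $\mathcal P(X)$ be the set of Borel probability measures on $X$, with any $\sigma$-algebra containing all singletons, and $W_2^2(\mu,\nu)=\inf_\pi\int\mathsf d^2(x,y)\,d\pi(x,y)$, where $\pi$ runs over the couplings of $\mu$ and $\nu$. For a measurable space $Y$ with $e:Y\times Y\to[0,\infty]$, the variance of a probability measure $\mu$ on $Y$ is $\inf_{x\in Y}\int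 e^2(x,y)\,d\mu(y)$, and a barycenter of a measure $\mu$ with finite variance is a point $x$ at which this infimum is attained. A Wasserstein barycenter is a barycenter for $Y=\mathcal P(X)$, $e=W_2$. 1. If every finitely supported probability measure with finite variance on $(X,\mathsf d)$ has a barycenter, then every finitely supported probability measure with finite variance on $(\mathcal P(X),W_2)$ has a Wasserstein barycenter. 2. If every measure $\frac1n\sum_{i=1}^n\delta_{x_i}$ with finite variance on $(X,\mathsf d)$ has a barycenter, then every measure $\frac1n\sum_{i=1}^n\delta_{\mu_i}$ with finite variance on $(\mathcal P(X),W_2)$ has a Wasserstein barycenter. 3. Fix $n$ and weights $\lambda$ as above, and suppose that $\sum_i\lambda_i\delta_{x_i}$ has a barycenter for all $x_1,\dots,x_n\in X$ for which it has finite variance. Then there is a universally measurable barycenter selection, i.e. a universally measurable map $T:X^n\to X$ such that $T(x_1,\dots,x_n)$ is a barycenter of $\sum_i\lambda_i\delta_{x_i}$ whenever this measure has finite variance. Let moreover $\mu_1,\dots,\mu_n\in\mathcal P(X)$ be such that $\Omega=\sum_i\lambda_i\delta_{\mu_i}$ has finite variance. Then there is an optimal multi-marginal plan, i.e. a minimizer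 $\pi$ of $\int_{X^n}c_\lambda\,d\pi$ among the probability measures on $X^n$ with marginals $\mu_1,\dots,\mu_n$; and for every such minimizer $\pi$ and every $\pi$-almost everywhere measurable barycenter selection $T$ (in particular, every Borel or universally measurable one), $T_\sharp\pi$ is a Wasserstein barycenter of $\Omega$. -/

import Mathlib

open MeasureTheory Filter Topology
open scoped ENNReal NNReal

noncomputable section

namespace WassersteinBarycenter

/-! ### Extended metrics and extended metric-topological spaces -/

/-- An extended metric on `Y`, i.e. a distance with values in `[0, ∞]`. -/
structure IsExtendedMetric {Y : Type*} (d : Y → Y → ℝ≥0∞) : Prop where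
  eq_zero_iff : ∀ x y, d x y = 0 ↔ x = y
  symm : ∀ x y, d x y = d y x
  triangle : ∀ x y z, d x z ≤ d x y + d y z

/-- Bounded functions, continuous for the topology of `X`, which are `L`-Lipschitz for `d`. -/
def lipBounded {X : Type*} [TopologicalSpace X] (d : X → X → ℝ≥0∞) (L : ℝ≥0) : Set (X → ℝ) :=
  {f | Continuous f ∧ (∃ C : ℝ, ∀ x, |f x| ≤ C) ∧
    ∀ x y, ENNReal.ofReal |f x - f y| ≤ (L : ℝ≥0∞) * d x y}

/-- `(X, τ, d)` is an extended metric-topological space: `d` is an extended metric, `τ` is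
Hausdorff, `τ` is generated by the bounded `τ`-continuous `d`-Lipschitz functions, and `d` is
recovered from those of them that are `1`-Lipschitz. -/
structure IsExtendedMetricTopological {X : Type*} [τ : TopologicalSpace X]
    (d : X → X → ℝ≥0∞) : Prop where
  isExtendedMetric : IsExtendedMetric d
  t2 : T2Space X
  generates : τ = ⨅ (L : ℝ≥0), ⨅ f ∈ lipBounded d L, TopologicalSpace.induced f inferInstance
  recovers : ∀ x y, d x y = ⨆ f ∈ lipBounded d 1, ENNReal.ofReal |f x - f y|

/-- The topology of `X` is the one whose neighbourhoods are generated by the `d`-balls. -/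
def IsTopologyOf {X : Type*} [TopologicalSpace X] (d : X → X → ℝ≥0∞) : Prop :=
  ∀ x : X, (𝓝 x).HasBasis (fun ε : ℝ≥0∞ => 0 < ε) (fun ε => {y | d x y < ε})

/-! ### Variance, barycenters and barycenter spaces -/

section Barycenter

variable {Y : Type*} [MeasurableSpace Y]

/-- `Var(μ) = inf_x ∫ e²(x, y) dμ(y)`, with values in `[0, ∞]`. -/
def variance (e : Y → Y → ℝ≥0∞) (μ : Measure Y) : ℝ≥0∞ :=
  ⨅ x, ∫⁻ y, e x y ^ 2 ∂μ

/-- `b` is a barycenter of `μ`: it realizes the variance, which is finite. -/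
def IsBarycenter (e : Y → Y → ℝ≥0∞) (μ : Measure Y) (b : Y) : Prop :=
  variance e μ < ∞ ∧ ∫⁻ y, e b y ^ 2 ∂μ = variance e μ

/-- `μ` is concentrated on a finite set. -/
def IsFinitelySupported (μ : Measure Y) : Prop :=
  ∃ S : Set Y, S.Finite ∧ μ Sᶜ = 0

/-- Every finitely supported probability measure with finite variance has a barycenter. -/
def IsBarycenterSpace (e : Y → Y → ℝ≥0∞) : Prop :=
  ∀ μ : Measure Y, IsProbabilityMeasure μ → IsFinitelySupported μ → variance e μ < ∞ →
    ∃ b, IsBarycenter e μ b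

/-- The discrete measure `∑ᵢ wᵢ δ_{xᵢ}`. -/
def discreteMeasure {n : ℕ} (w : Fin n → ℝ) (x : Fin n → Y) : Measure Y :=
  ∑ i, ENNReal.ofReal (w i) • Measure.dirac (x i)

/-- Every measure `(1/n) ∑ᵢ δ_{xᵢ}` with finite variance has a barycenter (the points `xᵢ` need
not be distinct). -/
def IsUniformBarycenterSpace (e : Y → Y → ℝ≥0∞) : Prop :=
  ∀ (n : ℕ) (_ : 0 < n) (x : Fin n → Y),
    variance e (discreteMeasure (fun _ => 1 / (n : ℝ)) x) < ∞ →
      ∃ b, IsBarycenter e (discreteMeasure (fun _ => 1 / (n : ℝ)) x) b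

/-- `T` maps every `n`-tuple `x` for which `∑ᵢ wᵢ δ_{xᵢ}` has finite variance to a barycenter of
this measure. -/
def IsBarycenterSelection (e : Y → Y → ℝ≥0∞) {n : ℕ} (w : Fin n → ℝ) (T : (Fin n → Y) → Y) :
    Prop :=
  ∀ x : Fin n → Y, variance e (discreteMeasure w x) < ∞ →
    IsBarycenter e (discreteMeasure w x) (T x)

end Barycenter

/-- Positive real weights of total mass `1`. -/
def IsWeight {n : ℕ} (w : Fin n → ℝ) : Prop :=
  (∀ i, 0 < w i) ∧ ∑ i, w i = 1

/-- `f` is measurable with respect to the completion of every Borel probability measure. (For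
a countably generated target this is almost everywhere measurability for all of them.) -/
def UniversallyMeasurable {Z Y : Type*} [MeasurableSpace Z] [MeasurableSpace Y] (f : Z → Y) :
    Prop :=
  ∀ ρ : Measure Z, IsProbabilityMeasure ρ → AEMeasurable f ρ

/-! ### The Wasserstein distance and multi-marginal optimal transport -/

section Transport

variable {X : Type*} [MeasurableSpace X]

/-- Transport plans with marginals `μ` and `ν`. -/
def couplings (μ ν : ProbabilityMeasure X) : Set (Measure (X × X)) :=
  {π | π.map Prod.fst = μ ∧ π.map Prod.snd = ν}

/-- The `L²`-Kantorovich-Wasserstein distance, with values in `[0, ∞]`. -/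
def W₂ (d : X → X → ℝ≥0∞) (μ ν : ProbabilityMeasure X) : ℝ≥0∞ :=
  (⨅ π ∈ couplings μ ν, ∫⁻ p, d p.1 p.2 ^ 2 ∂π) ^ (1 / 2 : ℝ)

/-- Multi-marginal transport plans with marginals `μ₁, …, μₙ`. -/
def multiCouplings {n : ℕ} (μ : Fin n → ProbabilityMeasure X) :
    Set (ProbabilityMeasure (Fin n → X)) :=
  {π | ∀ i, (π : Measure (Fin n → X)).map (fun x => x i) = μ i}

/-- The cost `c(x₁, …, xₙ) = inf_y ∑ᵢ wᵢ d²(xᵢ, y)`. -/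
def multiCost (d : X → X → ℝ≥0∞) {n : ℕ} (w : Fin n → ℝ) (x : Fin n → X) : ℝ≥0∞ :=
  ⨅ y, ∑ i, ENNReal.ofReal (w i) * d (x i) y ^ 2

/-- `π` solves the multi-marginal optimal transport problem of Kantorovich type between
`μ₁, …, μₙ` for the cost `multiCost d w`. -/
def IsOptimalMultiPlan (d : X → X → ℝ≥0∞) {n : ℕ} (w : Fin n → ℝ)
    (μ : Fin n → ProbabilityMeasure X) (π : ProbabilityMeasure (Fin n → X)) : Prop :=
  π ∈ multiCouplings μ ∧ ∀ π' ∈ multiCouplings μ,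
    ∫⁻ x, multiCost d w x ∂(π : Measure (Fin n → X)) ≤
      ∫⁻ x, multiCost d w x ∂(π' : Measure (Fin n → X))

end Transport

end WassersteinBarycenter

end

/-! For fixed weights, the Wasserstein variance of `∑ᵢ wᵢ δ_{μᵢ}` equals the minimal multi-marginal
cost `∫ c dπ` when it is finite and barycenters exist for these weights on `X`. Any `ν` is a
competitor no better than this minimum: near-optimal couplings of `ν` with the `μᵢ`, glued along
`ν`, give a multi-marginal plan, and the base point `y` is admissible in the infimum that defines
`c` (`exists_multiCoupling_lintegral_le`, `IsOptimalMultiPlan.lintegral_le_sum_W₂_sq`). Conversely,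
if `T` selects barycenters and `π` is optimal, the law of `(T x, xᵢ)` under `π` couples `T_♯π` with
`μᵢ`, so `T_♯π` attains the bound (`sum_W₂_sq_map_le`, `IsOptimalMultiPlan.isBarycenter_map`).

Two existence results remain. An optimal `π` exists since the plans form a compact set and `∫ c dπ`
is lower semicontinuous. A selection `T` exists since "`y` attains `c(x)`" is a Borel relation with
nonempty sections. Its universally measurable uniformization is built from scratch: analytic sets
are universally measurable, and leftmost preimages in Baire space depend on the point in a
universally measurable way. -/

namespace WassersteinBarycenter

/-! ### Analytic sets are universally measurable -/

section Analytic

variable {α : Type*} [TopologicalSpace α] [MeasurableSpace α]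

theorem isCompact_natBox (k : ℕ → ℕ) : IsCompact {σ : ℕ → ℕ | ∀ i, σ i ≤ k i} := by
  have : {τ : ℕ → ℕ | ∀ i, τ i ≤ k i} = Set.pi Set.univ fun i => Set.Iic (k i) := by
    ext τ; simp [Pi.le_def]
  rw [this]
  exact isCompact_univ_pi fun i => (Set.finite_Iic (k i)).isCompact

/-- Every neighbourhood of a compact box of Baire space contains one of the sets cut out by
finitely many of the constraints that define the box. -/
theorem exists_finite_box_subset (k : ℕ → ℕ) {U : Set (ℕ → ℕ)} (hU : IsOpen U)
    (hK : {σ : ℕ → ℕ | ∀ i, σ i ≤ k i} ⊆ U) :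
    ∃ m, {σ : ℕ → ℕ | ∀ i < m, σ i ≤ k i} ⊆ U := by
  by_contra! hcon
  have hcon' : ∀ m, ∃ σ : ℕ → ℕ, (∀ i < m, σ i ≤ k i) ∧ σ ∉ U := by
    intro m
    obtain ⟨σ, hσ, hσU⟩ := Set.not_subset.1 (hcon m)
    exact ⟨σ, hσ, hσU⟩
  choose σ hσ hσU using hcon'
  -- The sequences are truncated into the compact box. In coordinate `i` the truncation changes
  -- nothing once `m > i`, so the limit is also that of the original subsequence.
  obtain ⟨τ, hτ, φ, hφ, hlim⟩ := (isCompact_natBox k).tendsto_subseq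
    (x := fun m i => min (σ m i) (k i)) (fun m i => min_le_right _ _)
  have hlim' : Tendsto (fun m => σ (φ m)) atTop (𝓝 τ) := by
    rw [tendsto_pi_nhds] at hlim ⊢
    intro i
    refine (hlim i).congr' ?_
    filter_upwards [eventually_gt_atTop i] with m hm
    exact min_eq_left (hσ _ _ (hm.trans_le (hφ.id_le m)))
  obtain ⟨m, hm⟩ := (hlim'.eventually (hU.mem_nhds (hK hτ))).exists
  exact hσU _ hm

/-- The outer measure of an analytic set is approximated from inside by compact sets. -/
theorem exists_isCompact_le_measure_range (μ : Measure α) [μ.OuterRegular] {f : (ℕ → ℕ) → α}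
    (hf : Continuous f) {r : ℝ≥0∞} (hr : r < μ (Set.range f)) :
    ∃ K ⊆ Set.range f, IsCompact K ∧ r ≤ μ K := by
  -- Continuity along increasing unions holds for outer measures of arbitrary sets, so one more
  -- coordinate can be bounded while staying above `r`.
  have step : ∀ (S : Set (ℕ → ℕ)) (m : ℕ), r < μ (f '' S) →
      ∃ j : ℕ, r < μ (f '' (S ∩ {σ | σ m ≤ j})) := by
    intro S m hS
    have hmono : Monotone fun j : ℕ => f '' (S ∩ {σ | σ m ≤ j}) := fun a b hab =>
      Set.image_mono (Set.inter_subset_inter_right _ fun σ hσ => le_trans hσ hab)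
    have hun : f '' S = ⋃ j : ℕ, f '' (S ∩ {σ | σ m ≤ j}) := by
      rw [← Set.image_iUnion, ← Set.inter_iUnion]
      congr 1
      refine (Set.inter_eq_left.2 fun σ _ => ?_).symm
      exact Set.mem_iUnion.2 ⟨σ m, le_refl (σ m)⟩
    rw [hun, hmono.measure_iUnion, lt_iSup_iff] at hS
    exact hS
  choose! j hj using step
  let D : ℕ → Set (ℕ → ℕ) := fun m => Nat.rec Set.univ (fun m S => S ∩ {σ | σ m ≤ j S m}) m
  let k : ℕ → ℕ := fun m => j (D m) m
  have hDr : ∀ m, r < μ (f '' D m) := by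
    intro m
    induction m with
    | zero => simpa [D] using hr
    | succ m ih => exact hj _ _ ih
  have hD : ∀ m, D m ⊆ {σ | ∀ i < m, σ i ≤ k i} ∧ {σ | ∀ i < m, σ i ≤ k i} ⊆ D m := by
    intro m
    induction m with
    | zero => simp [D]
    | succ m ih =>
      constructor
      · intro σ hσ i hi
        rcases Nat.lt_succ_iff_lt_or_eq.1 hi with h | rfl
        · exact ih.1 hσ.1 i h
        · exact hσ.2
      · intro σ hσ
        exact ⟨ih.2 fun i hi => hσ i (hi.trans m.lt_succ_self), hσ m m.lt_succ_self⟩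
  refine ⟨f '' {σ | ∀ i, σ i ≤ k i}, Set.image_subset_range _ _, ?_, ?_⟩
  · exact (isCompact_natBox k).image hf
  -- Continuity from above fails for nonmeasurable sets. Outer regularity replaces it: each open set
  -- around the compact image already contains some `f '' D m`.
  · rw [Set.measure_eq_iInf_isOpen]
    refine le_iInf₂ fun U hU => le_iInf fun hUo => ?_
    obtain ⟨m, hm⟩ := exists_finite_box_subset k (hUo.preimage hf) (Set.image_subset_iff.1 hU)
    exact (hDr m).le.trans (measure_mono (Set.image_subset_iff.2 ((hD m).1.trans hm)))

/-- Analytic sets are measurable for the completion of every finite Borel measure. -/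
theorem nullMeasurableSet_range [T2Space α] [OpensMeasurableSpace α] (μ : Measure α)
    [IsFiniteMeasure μ] [μ.OuterRegular] {f : (ℕ → ℕ) → α} (hf : Continuous f) :
    NullMeasurableSet (Set.range f) μ := by
  rcases eq_or_ne (μ (Set.range f)) 0 with h0 | h0
  · exact .of_null h0
  obtain ⟨u, -, hu, hlim⟩ := exists_seq_strictMono_tendsto' (pos_iff_ne_zero.2 h0)
  choose K hKs hK hr using fun n => exists_isCompact_le_measure_range μ hf (hu n).2
  have hm : MeasurableSet (⋃ n, K n) := .iUnion fun n => (hK n).measurableSet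
  refine hm.nullMeasurableSet.congr (ae_eq_of_subset_of_measure_ge (Set.iUnion_subset hKs) ?_
    hm.nullMeasurableSet (measure_ne_top _ _))
  exact le_of_tendsto' hlim fun n => (hr n).trans (measure_mono (Set.subset_iUnion _ _))

end Analytic

/-! ### A selection theorem of Jankov and von Neumann -/

section Selection

variable {α : Type*}

/-- The sequences whose initial segment is the reversal of the list. -/
def listCylinder : List ℕ → Set (ℕ → ℕ)
  | [] => Set.univ
  | j :: l => listCylinder l ∩ {σ | σ l.length = j}

theorem isOpen_listCylinder (l : List ℕ) : IsOpen (listCylinder l) := by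
  induction l with
  | nil => exact isOpen_univ
  | cons j l ih => exact ih.inter ((isOpen_discrete ({j} : Set ℕ)).preimage
    (continuous_apply (A := fun _ : ℕ => ℕ) l.length))

/-- The least `j` such that `z` has a preimage in the cylinder of `j :: l`. -/
noncomputable def leastExtension (p : (ℕ → ℕ) → α) (l : List ℕ) (z : α) : ℕ :=
  sInf {j | z ∈ p '' listCylinder (j :: l)}

/-- The initial segments of the leftmost preimage of `z`, in reverse order. -/
noncomputable def leftmostList (p : (ℕ → ℕ) → α) (z : α) : ℕ → List ℕ
  | 0 => []
  | m + 1 => leastExtension p (leftmostList p z m) z :: leftmostList p z m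

/-- The leftmost preimage of `z`, with respect to the lexicographic order. -/
noncomputable def leftmost (p : (ℕ → ℕ) → α) (z : α) (m : ℕ) : ℕ :=
  leastExtension p (leftmostList p z m) z

theorem length_leftmostList (p : (ℕ → ℕ) → α) (z : α) (m : ℕ) :
    (leftmostList p z m).length = m := by
  induction m with
  | zero => rfl
  | succ m ih => simp [leftmostList, ih]

theorem mem_image_listCylinder_leftmostList (p : (ℕ → ℕ) → α) {z : α} (hz : z ∈ Set.range p)
    (m : ℕ) : z ∈ p '' listCylinder (leftmostList p z m) := by
  induction m with
  | zero => simpa [leftmostList, listCylinder] using hz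
  | succ m ih =>
    obtain ⟨σ, hσ, rfl⟩ := ih
    exact Nat.sInf_mem (s := {j | p σ ∈ p '' listCylinder (j :: leftmostList p (p σ) m)})
      ⟨σ (leftmostList p (p σ) m).length, σ, ⟨hσ, rfl⟩, rfl⟩

theorem eq_leftmost_of_mem_listCylinder (p : (ℕ → ℕ) → α) (z : α) {m : ℕ} {σ : ℕ → ℕ}
    (hσ : σ ∈ listCylinder (leftmostList p z m)) : ∀ i < m, σ i = leftmost p z i := by
  induction m with
  | zero => simp
  | succ m ih =>
    intro i hi
    rcases Nat.lt_succ_iff_lt_or_eq.1 hi with h | rfl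
    · exact ih hσ.1 i h
    · have := hσ.2
      rwa [Set.mem_ofPred_eq, length_leftmostList] at this

/-- Each initial segment of the leftmost sequence extends to a true preimage of `z`. These preimages
converge to that sequence, and fibres of `p` are closed. -/
theorem apply_leftmost [TopologicalSpace α] [T2Space α] {p : (ℕ → ℕ) → α} (hp : Continuous p) {z : α}
    (hz : z ∈ Set.range p) : p (leftmost p z) = z := by
  choose σ hσ hpσ using mem_image_listCylinder_leftmostList p hz
  have hlim : Tendsto σ atTop (𝓝 (leftmost p z)) := by
    rw [tendsto_pi_nhds]
    intro i
    refine tendsto_const_nhds.congr' ?_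
    filter_upwards [eventually_gt_atTop i] with m hm
    exact (eq_leftmost_of_mem_listCylinder p z (hσ m) i hm).symm
  refine tendsto_nhds_unique ((hp.tendsto _).comp hlim) ?_
  simp only [Function.comp_def, hpσ]
  exact tendsto_const_nhds

variable [TopologicalSpace α] [MeasurableSpace α] [T2Space α] [OpensMeasurableSpace α]

theorem nullMeasurableSet_image_listCylinder (μ : Measure α) [IsFiniteMeasure μ]
    [μ.OuterRegular] {p : (ℕ → ℕ) → α} (hp : Continuous p) (l : List ℕ) :
    NullMeasurableSet (p '' listCylinder l) μ := by
  have h := (isOpen_listCylinder l).analyticSet_image hp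
  rw [AnalyticSet] at h
  rcases h with h | ⟨f, hf, hfr⟩
  · rw [h]; exact nullMeasurableSet_empty
  · rw [← hfr]; exact nullMeasurableSet_range μ hf

theorem nullMeasurableSet_leastExtension_eq (μ : Measure α) [IsFiniteMeasure μ]
    [μ.OuterRegular] {p : (ℕ → ℕ) → α} (hp : Continuous p) (l : List ℕ) (j : ℕ) :
    NullMeasurableSet {z | leastExtension p l z = j} μ := by
  have hle : ∀ i, NullMeasurableSet {z | z ∈ p '' listCylinder (i :: l)} μ :=
    fun i => nullMeasurableSet_image_listCylinder μ hp _
  -- The second piece collects the points without any extension, where `sInf ∅ = 0` is the default.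
  have key : {z | leastExtension p l z = j} =
      ({z | z ∈ p '' listCylinder (j :: l)} ∩ ⋂ i ∈ Set.Iio j, {z | z ∈ p '' listCylinder (i :: l)}ᶜ) ∪
      ((⋂ i, {z | z ∈ p '' listCylinder (i :: l)}ᶜ) ∩ {_z | j = 0}) := by
    ext z
    simp only [Set.mem_ofPred_eq, Set.mem_union, Set.mem_inter_iff, Set.mem_iInter,
      Set.mem_compl_iff, Set.mem_Iio]
    rw [leastExtension]
    constructor
    · intro h
      by_cases hne : {i | z ∈ p '' listCylinder (i :: l)}.Nonempty
      · left
        subst h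
        exact ⟨Nat.sInf_mem hne, fun i hi => Nat.notMem_of_lt_sInf hi⟩
      · right
        rw [Set.not_nonempty_iff_eq_empty] at hne
        refine ⟨fun i hi => ?_, ?_⟩
        · have : i ∈ {i | z ∈ p '' listCylinder (i :: l)} := hi
          rw [hne] at this
          exact this
        · rw [← h, hne, Nat.sInf_empty]
    · rintro (⟨h1, h2⟩ | ⟨h1, rfl⟩)
      · refine le_antisymm (Nat.sInf_le h1) ?_
        by_contra! hlt
        exact h2 _ hlt (Nat.sInf_mem (s := {i | z ∈ p '' listCylinder (i :: l)}) ⟨j, h1⟩)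
      · have : {i | z ∈ p '' listCylinder (i :: l)} = ∅ := Set.eq_empty_of_forall_notMem h1
        rw [this, Nat.sInf_empty]
  rw [key]
  exact ((hle j).inter (.biInter (Set.to_countable _) fun i _ => (hle i).compl)).union
    ((NullMeasurableSet.iInter fun i => (hle i).compl).inter (.const _))

theorem nullMeasurableSet_leftmostList_eq (μ : Measure α) [IsFiniteMeasure μ]
    [μ.OuterRegular] {p : (ℕ → ℕ) → α} (hp : Continuous p) (m : ℕ) (l : List ℕ) :
    NullMeasurableSet {z | leftmostList p z m = l} μ := by
  induction m generalizing l with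
  | zero => exact NullMeasurableSet.const ([] = l)
  | succ m ih =>
    cases l with
    | nil => simp [leftmostList]
    | cons j l =>
      have : {z | leftmostList p z (m + 1) = j :: l} =
          {z | leftmostList p z m = l} ∩ {z | leastExtension p l z = j} := by
        ext z
        simp only [leftmostList, List.cons.injEq, Set.mem_ofPred_eq, Set.mem_inter_iff]
        constructor
        · rintro ⟨h1, rfl⟩; exact ⟨rfl, h1⟩
        · rintro ⟨rfl, h1⟩; exact ⟨h1, rfl⟩
      rw [this]
      exact (ih l).inter (nullMeasurableSet_leastExtension_eq μ hp l j)

/-- Each coordinate is determined by one of countably many finite lists, hence by countably many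
images of cylinders, which are analytic. -/
theorem aemeasurable_leftmost (μ : Measure α) [IsFiniteMeasure μ]
    [μ.OuterRegular] {p : (ℕ → ℕ) → α} (hp : Continuous p) : AEMeasurable (leftmost p) μ := by
  refine aemeasurable_pi_lambda _ fun m => NullMeasurable.aemeasurable fun s _ => ?_
  have : (fun z => leftmost p z m) ⁻¹' s =
      ⋃ j ∈ s, ⋃ l, {z | leftmostList p z m = l} ∩ {z | leastExtension p l z = j} := by
    ext z
    simp [leftmost]
  rw [this]
  exact .biUnion s.to_countable fun j _ => .iUnion fun l =>
    (nullMeasurableSet_leftmostList_eq μ hp m l).inter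
      (nullMeasurableSet_leastExtension_eq μ hp l j)

end Selection

/-- A Borel relation between Polish spaces all of whose sections are nonempty has a universally
measurable selection. -/
theorem exists_universallyMeasurable_selection {Z Y : Type*} [TopologicalSpace Z] [PolishSpace Z]
    [MeasurableSpace Z] [BorelSpace Z] [TopologicalSpace Y] [PolishSpace Y] [MeasurableSpace Y]
    [BorelSpace Y] {B : Set (Z × Y)} (hB : MeasurableSet B) (hne : ∀ z, ∃ y, (z, y) ∈ B) :
    ∃ T : Z → Y, UniversallyMeasurable T ∧ ∀ z, (z, T z) ∈ B := by
  have h := hB.analyticSet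
  rw [AnalyticSet] at h
  rcases h with rfl | ⟨f, hf, rfl⟩
  · have : IsEmpty Z := ⟨fun z => by simpa using hne z⟩
    exact ⟨isEmptyElim, fun ρ _ => (measurable_of_empty _).aemeasurable, isEmptyElim⟩
  -- With `B` parametrized by Baire space, a selection is the second coordinate of `f` at the
  -- leftmost parameter lying over `z`.
  · have hp : Continuous fun σ => (f σ).1 := continuous_fst.comp hf
    refine ⟨fun z => (f (leftmost (fun σ => (f σ).1) z)).2, fun ρ _ => ?_, fun z => ?_⟩
    · exact (continuous_snd.comp hf).measurable.comp_aemeasurable (aemeasurable_leftmost ρ hp)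
    · obtain ⟨y, σ, hσ⟩ := hne z
      refine ⟨leftmost (fun σ => (f σ).1) z, Prod.ext ?_ rfl⟩
      exact apply_leftmost hp ⟨σ, by simp [hσ]⟩

/-! ### Lower semicontinuity -/

section Semicontinuity

/-- Truncation makes the integrand finite. The layer-cake formula then reduces the claim to open
superlevel sets, where the portmanteau theorem applies, and Fatou's lemma integrates over the
levels. -/
theorem lowerSemicontinuous_lintegral {Ω : Type*} [TopologicalSpace Ω] [PolishSpace Ω]
    [MeasurableSpace Ω] [BorelSpace Ω] {c : Ω → ℝ≥0∞} (hc : LowerSemicontinuous c) :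
    LowerSemicontinuous fun μ : ProbabilityMeasure Ω => ∫⁻ x, c x ∂(μ : Measure Ω) := by
  have htrunc : ∀ x, c x = ⨆ n : ℕ, min (c x) n := by
    intro x
    rw [← inf_iSup_eq, ENNReal.iSup_natCast, inf_top_eq]
  have hlsc : ∀ n : ℕ, LowerSemicontinuous fun x => min (c x) (n : ℝ≥0∞) := fun n =>
    hc.inf lowerSemicontinuous_const
  have hint : (fun μ : ProbabilityMeasure Ω => ∫⁻ x, c x ∂(μ : Measure Ω)) =
      fun μ : ProbabilityMeasure Ω => ⨆ n : ℕ, ∫⁻ x, min (c x) n ∂(μ : Measure Ω) := by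
    funext μ
    rw [← lintegral_iSup (fun n => (hlsc n).measurable)]
    · exact lintegral_congr htrunc
    · exact fun a b hab x => min_le_min_left _ (by exact_mod_cast hab)
  rw [hint]
  refine lowerSemicontinuous_iSup fun n => ?_
  have hne : ∀ x, min (c x) (n : ℝ≥0∞) ≠ ∞ := fun x =>
    ((min_le_right _ _).trans_lt (ENNReal.natCast_lt_top n)).ne
  have hlayer : ∀ μ : ProbabilityMeasure Ω, ∫⁻ x, min (c x) n ∂(μ : Measure Ω) =
      ∫⁻ t in Set.Ioi (0 : ℝ), (μ : Measure Ω) {x | t < (min (c x) n).toReal} := by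
    intro μ
    rw [← lintegral_eq_lintegral_meas_lt _ (Eventually.of_forall fun _ => ENNReal.toReal_nonneg)
      (hlsc n).measurable.ennreal_toReal.aemeasurable]
    exact lintegral_congr fun x => (ENNReal.ofReal_toReal (hne x)).symm
  have hopen : ∀ t ∈ Set.Ioi (0 : ℝ), IsOpen {x | t < (min (c x) n).toReal} := by
    intro t ht
    have : {x | t < (min (c x) n).toReal} =
        (fun x => min (c x) (n : ℝ≥0∞)) ⁻¹' Set.Ioi (ENNReal.ofReal t) := by
      ext x
      exact (ENNReal.ofReal_lt_iff_lt_toReal (le_of_lt ht) (hne x)).symm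
    rw [this]
    exact (hlsc n).isOpen_preimage _
  refine fun μ => lowerSemicontinuousAt_iff_le_liminf.2 ?_
  simp_rw [hlayer]
  calc ∫⁻ t in Set.Ioi (0 : ℝ), (μ : Measure Ω) {x | t < (min (c x) n).toReal}
      ≤ ∫⁻ t in Set.Ioi (0 : ℝ), liminf (fun ν : ProbabilityMeasure Ω =>
          (ν : Measure Ω) {x | t < (min (c x) n).toReal}) (𝓝 μ) :=
        setLIntegral_mono' measurableSet_Ioi fun t ht =>
          ProbabilityMeasure.le_liminf_measure_open_of_tendsto tendsto_id (hopen t ht)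
    _ ≤ _ := lintegral_liminf_le fun ν => Antitone.measurable fun s t hst =>
        measure_mono fun x hx => lt_of_le_of_lt hst hx

variable {X : Type*} [TopologicalSpace X] {d : X → X → ℝ≥0∞}

theorem IsExtendedMetricTopological.lowerSemicontinuous (hd : IsExtendedMetricTopological d) :
    LowerSemicontinuous fun p : X × X => d p.1 p.2 := by
  simp_rw [hd.recovers]
  refine lowerSemicontinuous_iSup fun f => lowerSemicontinuous_iSup fun hf => ?_
  have := hf.1
  exact (ENNReal.continuous_ofReal.comp (by fun_prop)).lowerSemicontinuous

theorem IsExtendedMetricTopological.measurable_sq [PolishSpace X] [MeasurableSpace X]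
    [BorelSpace X] (hd : IsExtendedMetricTopological d) :
    Measurable fun p : X × X => d p.1 p.2 ^ 2 :=
  hd.lowerSemicontinuous.measurable.pow_const 2

theorem sum_ofReal_eq_one {n : ℕ} {w : Fin n → ℝ} (hw : IsWeight w) :
    ∑ i, ENNReal.ofReal (w i) = 1 := by
  rw [← ENNReal.ofReal_sum_of_nonneg fun i _ => (hw.1 i).le, hw.2, ENNReal.ofReal_one]

/-- From `2b ≤ 1 + b²`. The error vanishes with `η` and depends on `b` only through `b²`, so it can
be summed against the weights. -/
theorem add_sq_le_one_add_mul (b η : ℝ≥0∞) : (η + b) ^ 2 ≤ (1 + η) * (b ^ 2 + η) := by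
  have hb' : b + b ≤ 1 + b ^ 2 := by
    rcases eq_or_ne b ∞ with rfl | h
    · simp
    · lift b to ℝ≥0 using h
      norm_cast
      rw [← NNReal.coe_le_coe]
      push_cast
      nlinarith [sq_nonneg ((b : ℝ) - 1)]
  calc (η + b) ^ 2 = η ^ 2 + b ^ 2 + η * (b + b) := by ring
    _ ≤ η ^ 2 + b ^ 2 + η * (1 + b ^ 2) := by gcongr
    _ = (1 + η) * (b ^ 2 + η) := by ring

/-- The costs are lower semicontinuous if the topology is the one of the extended metric. -/
theorem lowerSemicontinuous_multiCost (hd : IsExtendedMetric d) (hτ : IsTopologyOf d) {n : ℕ}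
    {w : Fin n → ℝ} (hw : IsWeight w) : LowerSemicontinuous (multiCost d w) := by
  intro x a ha
  obtain ⟨b, hab, hb⟩ := exists_between ha
  by_contra hcon
  rw [not_eventually] at hcon
  -- A point `x'` within `η` of `x` has cost below `b`. A `y` witnessing this is tested at `x`;
  -- letting `η → 0` contradicts `b < multiCost d w x`.
  have hle : ∀ η : ℝ≥0∞, 0 < η → multiCost d w x ≤ (1 + η) * (b + η) := by
    intro η hη
    have hnear : ∀ᶠ x' in 𝓝 x, ∀ i, d (x i) (x' i) < η := by
      rw [eventually_all]
      exact fun i => (continuous_apply i).continuousAt.eventually ((hτ (x i)).mem_of_mem hη)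
    obtain ⟨x', hx', hη'⟩ := (hcon.and_eventually hnear).exists
    obtain ⟨y, hy⟩ := iInf_lt_iff.1 ((not_lt.1 hx').trans_lt hab)
    calc multiCost d w x ≤ ∑ i, ENNReal.ofReal (w i) * d (x i) y ^ 2 := iInf_le _ y
      _ ≤ ∑ i, ENNReal.ofReal (w i) * ((1 + η) * (d (x' i) y ^ 2 + η)) := by
        gcongr with i
        refine le_trans ?_ (add_sq_le_one_add_mul _ _)
        gcongr
        exact (hd.triangle _ _ _).trans (by gcongr; exact (hη' i).le)
      _ = (1 + η) * (∑ i, ENNReal.ofReal (w i) * d (x' i) y ^ 2 +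
            (∑ i, ENNReal.ofReal (w i)) * η) := by
        rw [Finset.sum_mul, ← Finset.sum_add_distrib, Finset.mul_sum]
        exact Finset.sum_congr rfl fun i _ => by ring
      _ ≤ (1 + η) * (b + η) := by rw [sum_ofReal_eq_one hw, one_mul]; gcongr
  have hbt : b ≠ ∞ := (hb.trans_le le_top).ne
  have hlim : Tendsto (fun η : ℝ≥0∞ => (1 + η) * (b + η)) (𝓝[>] 0) (𝓝 ((1 + 0) * (b + 0))) := by
    refine Tendsto.mono_left ?_ nhdsWithin_le_nhds
    refine ENNReal.Tendsto.mul (tendsto_const_nhds.add tendsto_id) (by simp)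
      (tendsto_const_nhds.add tendsto_id) (by simp)
  rw [add_zero, add_zero, one_mul] at hlim
  have : multiCost d w x ≤ b := ge_of_tendsto hlim <| by
    filter_upwards [self_mem_nhdsWithin] with η hη using hle η hη
  exact absurd hb this.not_gt

end Semicontinuity

/-! ### Multi-marginal plans -/

section Plans

variable {X : Type*} [MeasurableSpace X]

theorem multiCouplings_nonempty {n : ℕ} (μ : Fin n → ProbabilityMeasure X) :
    (multiCouplings μ).Nonempty :=
  ⟨ProbabilityMeasure.pi μ, fun i => (measurePreserving_eval _ i).map_eq⟩

variable [TopologicalSpace X] [PolishSpace X] [BorelSpace X]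

theorem isClosed_multiCouplings {n : ℕ} (μ : Fin n → ProbabilityMeasure X) :
    IsClosed (multiCouplings μ) := by
  have h : multiCouplings μ = ⋂ i, (fun π : ProbabilityMeasure (Fin n → X) =>
      π.map (f := fun x => x i) (measurable_pi_apply i).aemeasurable) ⁻¹' {μ i} := by
    ext π
    simp only [multiCouplings, Set.mem_ofPred_eq, Set.mem_iInter, Set.mem_preimage,
      Set.mem_singleton_iff]
    exact forall_congr' fun i => ⟨fun h => Subtype.ext h, fun h => congrArg Subtype.val h⟩
  rw [h]
  exact isClosed_iInter fun i =>
    isClosed_singleton.preimage (ProbabilityMeasure.continuous_map (continuous_apply i))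

/-- Each marginal is tight, and the complement of a product of compacts is controlled by a union
bound over the fixed marginals. -/
theorem isTightMeasureSet_multiCouplings {n : ℕ} (μ : Fin n → ProbabilityMeasure X) :
    IsTightMeasureSet {((π : ProbabilityMeasure (Fin n → X)) : Measure (Fin n → X)) |
      π ∈ multiCouplings μ} := by
  rw [isTightMeasureSet_iff_exists_isCompact_measure_compl_le]
  intro ε hε
  obtain ⟨δ, hδ, hδε⟩ := ENNReal.exists_pos_sum_of_countable hε.ne' (Fin n)
  have hK : ∀ i, ∃ K : Set X, IsCompact K ∧ (μ i : Measure X) Kᶜ ≤ δ i := by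
    intro i
    obtain ⟨K, hK, h⟩ := isTightMeasureSet_iff_exists_isCompact_measure_compl_le.1
      (isTightMeasureSet_singleton (μ := (μ i : Measure X))) (δ i) (by exact_mod_cast hδ i)
    exact ⟨K, hK, h _ rfl⟩
  choose K hK hμK using hK
  refine ⟨Set.pi Set.univ K, isCompact_univ_pi hK, ?_⟩
  rintro _ ⟨π, hπ, rfl⟩
  calc (π : Measure (Fin n → X)) (Set.pi Set.univ K)ᶜ
      ≤ (π : Measure (Fin n → X)) (⋃ i, (fun x => x i) ⁻¹' (K i)ᶜ) :=
        measure_mono fun x hx => by simpa [Set.mem_pi] using hx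
    _ ≤ ∑' i, (π : Measure (Fin n → X)) ((fun x => x i) ⁻¹' (K i)ᶜ) := measure_iUnion_le _
    _ ≤ ∑' i, (δ i : ℝ≥0∞) := by
        refine ENNReal.tsum_le_tsum fun i => ?_
        rw [← Measure.map_apply (measurable_pi_apply i) (hK i).measurableSet.compl, hπ i]
        exact hμK i
    _ ≤ ε := hδε.le

theorem isCompact_multiCouplings {n : ℕ} (μ : Fin n → ProbabilityMeasure X) :
    IsCompact (multiCouplings μ) := by
  rw [← (isClosed_multiCouplings μ).closure_eq]
  exact isCompact_closure_of_isTightMeasureSet (isTightMeasureSet_multiCouplings μ)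

theorem exists_isOptimalMultiPlan {d : X → X → ℝ≥0∞} {n : ℕ} {w : Fin n → ℝ}
    (hc : LowerSemicontinuous (multiCost d w)) (μ : Fin n → ProbabilityMeasure X) :
    ∃ π, IsOptimalMultiPlan d w μ π := by
  obtain ⟨π, hπ, hmin⟩ := ((lowerSemicontinuous_lintegral hc).lowerSemicontinuousOn _).exists_isMinOn
    (multiCouplings_nonempty μ) (isCompact_multiCouplings μ)
  exact ⟨π, hπ, fun π' hπ' => hmin hπ'⟩

/-- Couplings of `ν` with each of the `μ i` can be glued along `ν`. -/
theorem exists_multiCoupling_lintegral_le {d : X → X → ℝ≥0∞}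
    (hd : IsExtendedMetric d) (hdm : Measurable fun p : X × X => d p.1 p.2 ^ 2)
    {n : ℕ} {w : Fin n → ℝ} (hcm : Measurable (multiCost d w)) (μ : Fin n → ProbabilityMeasure X)
    (ν : ProbabilityMeasure X) (γ : Fin n → Measure (X × X)) (hγ : ∀ i, γ i ∈ couplings ν (μ i)) :
    ∃ π ∈ multiCouplings μ, ∫⁻ x, multiCost d w x ∂(π : Measure (Fin n → X)) ≤
      ∑ i, ENNReal.ofReal (w i) * ∫⁻ p, d p.1 p.2 ^ 2 ∂(γ i) := by
  have hne : Nonempty X := ν.nonempty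
  have hprob : ∀ i, IsProbabilityMeasure (γ i) := fun i => by
    have : IsProbabilityMeasure ((γ i).map Prod.fst) := by rw [(hγ i).1]; infer_instance
    exact Measure.isProbabilityMeasure_of_map Prod.fst
  -- Given `y`, the points `xᵢ` are drawn independently from the conditional laws of the `γ i`;
  -- averaging over `ν` yields the plan.
  let κ : X → Measure (Fin n → X) := fun y => Measure.pi fun i => (γ i).condKernel y
  have hκ : Measurable κ := by
    refine Measurable.measure_of_isPiSystem_of_isProbabilityMeasure generateFrom_pi.symm
      isPiSystem_pi ?_
    rintro _ ⟨s, hs, rfl⟩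
    simp only [κ, Measure.pi_pi]
    exact Finset.measurable_prod _ fun i _ =>
      (γ i).condKernel.measurable_coe (hs i (Set.mem_univ i))
  have hmarg : ∀ (i : Fin n) (y : X), (κ y).map (fun x => x i) = (γ i).condKernel y :=
    fun i y => (measurePreserving_eval _ i).map_eq
  have hdis : ∀ (i : Fin n) (f : X × X → ℝ≥0∞), Measurable f →
      ∫⁻ y, ∫⁻ z, f (y, z) ∂(γ i).condKernel y ∂(ν : Measure X) = ∫⁻ p, f p ∂(γ i) := by
    intro i f hf
    rw [← (hγ i).1]
    exact Measure.lintegral_condKernel hf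
  have hbind : IsProbabilityMeasure ((ν : Measure X).bind κ) := ⟨by
    rw [Measure.bind_apply .univ hκ.aemeasurable]
    simp [κ]⟩
  refine ⟨⟨(ν : Measure X).bind κ, hbind⟩, fun i => ?_, ?_⟩
  · ext s hs
    change ((ν : Measure X).bind κ).map (fun x => x i) s = _
    rw [Measure.map_apply (measurable_pi_apply i) hs,
      Measure.bind_apply (measurable_pi_apply i hs) hκ.aemeasurable, ← (hγ i).2,
      Measure.map_apply measurable_snd hs, ← lintegral_indicator_one (measurable_snd hs),
      ← hdis i _ (measurable_one.indicator (measurable_snd hs))]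
    refine lintegral_congr fun y => ?_
    rw [← Measure.map_apply (measurable_pi_apply i) hs, hmarg, ← lintegral_indicator_one hs]
    rfl
  · change ∫⁻ x, multiCost d w x ∂((ν : Measure X).bind κ) ≤ _
    have hm : ∀ (i : Fin n) (y : X), Measurable fun x : Fin n → X => d y (x i) ^ 2 := fun i y =>
      hdm.comp (measurable_const.prodMk (measurable_pi_apply i))
    rw [Measure.lintegral_bind hκ.aemeasurable hcm.aemeasurable]
    calc ∫⁻ y, ∫⁻ x, multiCost d w x ∂κ y ∂(ν : Measure X)
        ≤ ∫⁻ y, ∑ i, ENNReal.ofReal (w i) * ∫⁻ z, d y z ^ 2 ∂(γ i).condKernel y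
            ∂(ν : Measure X) := by
          refine lintegral_mono fun y => ?_
          calc ∫⁻ x, multiCost d w x ∂κ y
              ≤ ∫⁻ x, ∑ i, ENNReal.ofReal (w i) * d y (x i) ^ 2 ∂κ y := by
                refine lintegral_mono fun x => (iInf_le _ y).trans_eq ?_
                exact Finset.sum_congr rfl fun i _ => by rw [hd.symm]
            _ = ∑ i, ENNReal.ofReal (w i) * ∫⁻ z, d y z ^ 2 ∂(γ i).condKernel y := by
                rw [lintegral_finsetSum _ fun i _ => (hm i y).const_mul _]
                refine Finset.sum_congr rfl fun i _ => ?_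
                have hy : Measurable fun z => d y z ^ 2 :=
                  hdm.comp (measurable_const.prodMk measurable_id)
                rw [lintegral_const_mul _ (hm i y), ← hmarg,
                  lintegral_map hy (measurable_pi_apply i)]
      _ = ∑ i, ENNReal.ofReal (w i) * ∫⁻ p, d p.1 p.2 ^ 2 ∂(γ i) := by
          have hmk : ∀ i, Measurable fun y => ∫⁻ z, d y z ^ 2 ∂(γ i).condKernel y := fun i =>
            hdm.lintegral_kernel_prod_right'
          rw [lintegral_finsetSum _ fun i _ => (hmk i).const_mul _]
          refine Finset.sum_congr rfl fun i _ => ?_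
          rw [lintegral_const_mul _ (hmk i), ← hdis i _ hdm]

end Plans

/-! ### Discrete measures -/

section Discrete

variable {Y : Type*} [MeasurableSpace Y] [MeasurableSingletonClass Y]

theorem lintegral_discreteMeasure {n : ℕ} (w : Fin n → ℝ) (x : Fin n → Y) (f : Y → ℝ≥0∞) :
    ∫⁻ y, f y ∂(discreteMeasure w x) = ∑ i, ENNReal.ofReal (w i) * f (x i) := by
  simp [discreteMeasure, lintegral_finsetSum_measure, lintegral_smul_measure]

theorem isProbabilityMeasure_discreteMeasure {n : ℕ} {w : Fin n → ℝ} (hw : IsWeight w)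
    (x : Fin n → Y) : IsProbabilityMeasure (discreteMeasure w x) := ⟨by
  rw [← lintegral_one, lintegral_discreteMeasure]
  simpa using sum_ofReal_eq_one hw⟩

theorem isFinitelySupported_discreteMeasure {n : ℕ} (w : Fin n → ℝ) (x : Fin n → Y) :
    IsFinitelySupported (discreteMeasure w x) := by
  refine ⟨Set.range x, Set.finite_range x, ?_⟩
  have hm := (Set.finite_range x).measurableSet.compl
  rw [← lintegral_indicator_one hm, lintegral_discreteMeasure]
  simp

/-- Finitely supported probability measures are of the form `∑ᵢ wᵢ δ_{xᵢ}`. -/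
theorem exists_eq_discreteMeasure (μ : Measure Y) [IsProbabilityMeasure μ]
    (hμ : IsFinitelySupported μ) :
    ∃ (n : ℕ) (w : Fin n → ℝ) (x : Fin n → Y), IsWeight w ∧ μ = discreteMeasure w x := by
  classical
  obtain ⟨S, hS, hSμ⟩ := hμ
  -- Null points of the support are discarded because weights must be strictly positive.
  let F : Finset Y := hS.toFinset.filter fun y => μ {y} ≠ 0
  have hF : μ (F : Set Y)ᶜ = 0 := by
    refine measure_mono_null (t := Sᶜ ∪ ⋃ y ∈ hS.toFinset.filter fun y => μ {y} = 0, {y}) ?_ ?_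
    · intro y hy
      by_cases hyS : y ∈ S
      · right
        have : μ {y} = 0 := by
          by_contra h
          exact hy (by simp [F, hyS, h])
        simp [hyS, this]
      · exact Or.inl hyS
    · refine measure_union_null hSμ ((measure_biUnion_null_iff (Finset.countable_toSet _)).2 ?_)
      intro y hy
      exact (Finset.mem_filter.1 hy).2
  have hsum : ∀ A : Set Y, μ A = ∑ y ∈ F, μ {y} * A.indicator 1 y := by
    intro A
    have h1 : μ A = μ (F.filter (· ∈ A) : Finset Y) := by
      rw [← measure_inter_add_sdiff A F.measurableSet,
        measure_mono_null (fun y hy => hy.2 : A \ F ⊆ (F : Set Y)ᶜ) hF, add_zero]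
      congr 1
      ext y
      simp [and_comm]
    rw [h1, ← sum_measure_singleton, Finset.sum_filter]
    refine Finset.sum_congr rfl fun y _ => ?_
    by_cases hy : y ∈ A <;> simp [hy]
  have hfin : ∀ y, ENNReal.ofReal (μ {y}).toReal = μ {y} := fun y =>
    ENNReal.ofReal_toReal (measure_ne_top _ _)
  refine ⟨F.card, fun i => (μ {(F.equivFin.symm i : Y)}).toReal, fun i => F.equivFin.symm i,
    ⟨fun i => ?_, ?_⟩, ?_⟩
  · exact ENNReal.toReal_pos (Finset.mem_filter.1 (F.equivFin.symm i).2).2 (measure_ne_top _ _)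
  · rw [F.equivFin.symm.sum_comp fun y : F => (μ {(y : Y)}).toReal,
      Finset.sum_coe_sort F fun y => (μ {y}).toReal,
      ← ENNReal.toReal_sum fun y _ => measure_ne_top _ _]
    have := hsum Set.univ
    simp only [measure_univ, Set.indicator_univ, Pi.one_apply, mul_one] at this
    rw [← this, ENNReal.toReal_one]
  · ext A hA
    rw [← lintegral_indicator_one (μ := discreteMeasure _ _) hA, lintegral_discreteMeasure]
    simp only [hfin]
    rw [F.equivFin.symm.sum_comp fun y : F => μ {(y : Y)} * A.indicator 1 (y : Y),
      Finset.sum_coe_sort F fun y => μ {y} * A.indicator 1 y, hsum]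

end Discrete

/-! ### Wasserstein barycenters -/

section Main

theorem W₂_sq {X : Type*} [MeasurableSpace X] (d : X → X → ℝ≥0∞) (μ ν : ProbabilityMeasure X) :
    W₂ d μ ν ^ 2 = ⨅ π ∈ couplings μ ν, ∫⁻ p, d p.1 p.2 ^ 2 ∂π := by
  rw [W₂, ← ENNReal.rpow_natCast, ← ENNReal.rpow_mul]
  norm_num

theorem variance_discreteMeasure {Y : Type*} [MeasurableSpace Y] [MeasurableSingletonClass Y]
    (e : Y → Y → ℝ≥0∞) {n : ℕ} (w : Fin n → ℝ) (x : Fin n → Y) :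
    variance e (discreteMeasure w x) = ⨅ y, ∑ i, ENNReal.ofReal (w i) * e y (x i) ^ 2 := by
  simp only [variance, lintegral_discreteMeasure]

theorem variance_discreteMeasure_eq_multiCost {Y : Type*} [MeasurableSpace Y]
    [MeasurableSingletonClass Y] {d : Y → Y → ℝ≥0∞} (hd : IsExtendedMetric d) {n : ℕ}
    (w : Fin n → ℝ) (x : Fin n → Y) :
    variance d (discreteMeasure w x) = multiCost d w x := by
  rw [variance_discreteMeasure]
  exact iInf_congr fun y => Finset.sum_congr rfl fun i _ => by rw [hd.symm]

variable {X : Type*} [TopologicalSpace X] [PolishSpace X] [MeasurableSpace X] [BorelSpace X]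
  {d : X → X → ℝ≥0∞} {n : ℕ} {w : Fin n → ℝ}

theorem exists_barycenterSelection (hd : IsExtendedMetricTopological d) (hw : IsWeight w)
    (hcm : Measurable (multiCost d w))
    (hb : ∀ x : Fin n → X, variance d (discreteMeasure w x) < ∞ →
      ∃ b, IsBarycenter d (discreteMeasure w x) b) :
    ∃ T : (Fin n → X) → X, UniversallyMeasurable T ∧ IsBarycenterSelection d w T := by
  -- Only `≤` is needed, as the reverse inequality is automatic.
  let B : Set ((Fin n → X) × X) :=
    {p | ∑ i, ENNReal.ofReal (w i) * d p.2 (p.1 i) ^ 2 ≤ multiCost d w p.1}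
  have hB : MeasurableSet B := by
    refine measurableSet_le (Finset.measurable_sum _ fun i _ => Measurable.const_mul ?_ _)
      (hcm.comp measurable_fst)
    exact hd.measurable_sq.comp
      (measurable_snd.prodMk ((measurable_pi_apply i).comp measurable_fst))
  have hn : Nonempty (Fin n) := by
    by_contra h
    rw [not_nonempty_iff] at h
    simpa using hw.2
  obtain ⟨T, hT, hTB⟩ := exists_universallyMeasurable_selection hB (fun x => by
    rcases lt_or_ge (multiCost d w x) ∞ with h | h
    · rw [← variance_discreteMeasure_eq_multiCost hd.isExtendedMetric] at h
      obtain ⟨b, -, hbx⟩ := hb x h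
      rw [lintegral_discreteMeasure,
        variance_discreteMeasure_eq_multiCost hd.isExtendedMetric] at hbx
      exact ⟨b, hbx.le⟩
    -- At infinite cost every point qualifies; one exists because weights of sum `1` force `n > 0`.
    · exact ⟨x hn.some, le_top.trans h⟩)
  refine ⟨T, hT, fun x hx => ⟨hx, le_antisymm ?_ (iInf_le _ _)⟩⟩
  rw [lintegral_discreteMeasure, variance_discreteMeasure_eq_multiCost hd.isExtendedMetric]
  exact hTB x

/-- The optimal multi-marginal cost is a lower bound for the Wasserstein variance. -/
theorem IsOptimalMultiPlan.lintegral_le_sum_W₂_sq (hd : IsExtendedMetricTopological d)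
    (hw : IsWeight w) (hcm : Measurable (multiCost d w)) {μ : Fin n → ProbabilityMeasure X}
    {π : ProbabilityMeasure (Fin n → X)} (hπ : IsOptimalMultiPlan d w μ π)
    (ν : ProbabilityMeasure X) :
    ∫⁻ x, multiCost d w x ∂(π : Measure (Fin n → X)) ≤
      ∑ i, ENNReal.ofReal (w i) * W₂ d ν (μ i) ^ 2 := by
  refine le_of_forall_gt fun a ha => ?_
  have hwpos : ∀ i, ENNReal.ofReal (w i) ≠ 0 := fun i =>
    (ENNReal.ofReal_pos.2 (hw.1 i)).ne'
  have hfin : ∀ i, W₂ d ν (μ i) ^ 2 ≠ ∞ := by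
    intro i h
    refine (lt_of_lt_of_le ha le_top).ne (ENNReal.sum_eq_top.2 ⟨i, Finset.mem_univ i, ?_⟩)
    rw [h, ENNReal.mul_top (hwpos i)]
  obtain ⟨ε, hε, hεa⟩ : ∃ ε : ℝ≥0∞, 0 < ε ∧
      (∑ i, ENNReal.ofReal (w i) * W₂ d ν (μ i) ^ 2) + ε < a := by
    obtain ⟨b, hb, hba⟩ := exists_between ha
    refine ⟨b - ∑ i, ENNReal.ofReal (w i) * W₂ d ν (μ i) ^ 2, tsub_pos_of_lt hb, ?_⟩
    rwa [add_tsub_cancel_of_le hb.le]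
  -- Near-optimal couplings suffice; since the weights sum to `1`, the total error is exactly `ε`.
  have hγ : ∀ i, ∃ γ ∈ couplings ν (μ i),
      ∫⁻ p, d p.1 p.2 ^ 2 ∂γ < W₂ d ν (μ i) ^ 2 + ε := by
    intro i
    have h := ENNReal.lt_add_right (hfin i) hε.ne'
    conv at h => lhs; rw [W₂_sq]
    simpa only [iInf_lt_iff, exists_prop] using h
  choose γ hγ hγε using hγ
  obtain ⟨π', hπ', hle⟩ := exists_multiCoupling_lintegral_le hd.isExtendedMetric hd.measurable_sq
    hcm μ ν γ hγ
  calc ∫⁻ x, multiCost d w x ∂(π : Measure (Fin n → X))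
      ≤ ∑ i, ENNReal.ofReal (w i) * ∫⁻ p, d p.1 p.2 ^ 2 ∂(γ i) := (hπ.2 π' hπ').trans hle
    _ ≤ ∑ i, ENNReal.ofReal (w i) * (W₂ d ν (μ i) ^ 2 + ε) := by
        gcongr with i
        exact (hγε i).le
    _ = (∑ i, ENNReal.ofReal (w i) * W₂ d ν (μ i) ^ 2) + ε := by
        simp_rw [mul_add, Finset.sum_add_distrib]
        rw [← Finset.sum_mul, sum_ofReal_eq_one hw, one_mul]
    _ < a := hεa

/-- The law of `(T x, xᵢ)` under `π` is an admissible coupling for each `i`. -/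
theorem sum_W₂_sq_map_le (hd : IsExtendedMetricTopological d)
    {μ : Fin n → ProbabilityMeasure X} {π : ProbabilityMeasure (Fin n → X)}
    (hπ : π ∈ multiCouplings μ) {T : (Fin n → X) → X}
    (hT : AEMeasurable T (π : Measure (Fin n → X))) :
    ∑ i, ENNReal.ofReal (w i) * W₂ d (π.map hT) (μ i) ^ 2 ≤
      ∫⁻ x, ∑ i, ENNReal.ofReal (w i) * d (T x) (x i) ^ 2 ∂(π : Measure (Fin n → X)) := by
  have hpair : ∀ i, AEMeasurable (fun x => (T x, x i)) (π : Measure (Fin n → X)) := fun i =>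
    hT.prodMk (measurable_pi_apply i).aemeasurable
  have hm : ∀ i, AEMeasurable (fun x => d (T x) (x i) ^ 2) (π : Measure (Fin n → X)) := fun i =>
    hd.measurable_sq.comp_aemeasurable (hpair i)
  rw [lintegral_finsetSum' _ fun i _ => (hm i).const_mul _]
  gcongr with i
  rw [lintegral_const_mul'' _ (hm i), W₂_sq]
  gcongr
  refine (iInf₂_le ((π : Measure (Fin n → X)).map fun x => (T x, x i)) ⟨?_, ?_⟩).trans_eq
    (lintegral_map' hd.measurable_sq.aemeasurable (hpair i))
  · rw [AEMeasurable.map_map_of_aemeasurable measurable_fst.aemeasurable (hpair i)]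
    rfl
  · rw [AEMeasurable.map_map_of_aemeasurable measurable_snd.aemeasurable (hpair i)]
    exact hπ i

variable [MeasurableSpace (ProbabilityMeasure X)]
  [MeasurableSingletonClass (ProbabilityMeasure X)]

/-- Pushing an optimal multi-marginal plan forward under a barycenter selection gives a
Wasserstein barycenter. -/
theorem IsOptimalMultiPlan.isBarycenter_map (hd : IsExtendedMetricTopological d)
    (hw : IsWeight w) (hcm : Measurable (multiCost d w)) {μ : Fin n → ProbabilityMeasure X}
    (hμ : variance (W₂ d) (discreteMeasure w μ) < ∞) {π : ProbabilityMeasure (Fin n → X)}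
    (hπ : IsOptimalMultiPlan d w μ π) {T : (Fin n → X) → X}
    (hT : AEMeasurable T (π : Measure (Fin n → X))) (hTb : IsBarycenterSelection d w T) :
    IsBarycenter (W₂ d) (discreteMeasure w μ) (π.map hT) := by
  have hle : ∫⁻ x, multiCost d w x ∂(π : Measure (Fin n → X)) ≤
      variance (W₂ d) (discreteMeasure w μ) := by
    rw [variance_discreteMeasure]
    exact le_iInf fun ν => hπ.lintegral_le_sum_W₂_sq hd hw hcm ν
  -- Finite Wasserstein variance makes the cost finite `π`-almost everywhere, which is where `T` is
  -- known to pick barycenters.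
  have hae : ∀ᵐ x ∂(π : Measure (Fin n → X)),
      ∑ i, ENNReal.ofReal (w i) * d (T x) (x i) ^ 2 = multiCost d w x := by
    filter_upwards [ae_lt_top hcm (hle.trans_lt hμ).ne] with x hx
    rw [← variance_discreteMeasure_eq_multiCost hd.isExtendedMetric] at hx ⊢
    rw [← (hTb x hx).2, lintegral_discreteMeasure]
  refine ⟨hμ, le_antisymm ?_ (iInf_le _ _)⟩
  rw [lintegral_discreteMeasure]
  exact (sum_W₂_sq_map_le hd hπ.1 hT).trans ((lintegral_congr_ae hae).trans_le hle)

theorem exists_wassersteinBarycenter (hd : IsExtendedMetricTopological d)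
    (hw : IsWeight w) (hc : LowerSemicontinuous (multiCost d w))
    (hb : ∀ x : Fin n → X, variance d (discreteMeasure w x) < ∞ →
      ∃ b, IsBarycenter d (discreteMeasure w x) b) {μ : Fin n → ProbabilityMeasure X}
    (hμ : variance (W₂ d) (discreteMeasure w μ) < ∞) :
    ∃ b, IsBarycenter (W₂ d) (discreteMeasure w μ) b := by
  obtain ⟨T, hT, hTb⟩ := exists_barycenterSelection hd hw hc.measurable hb
  obtain ⟨π, hπ⟩ := exists_isOptimalMultiPlan hc μ
  exact ⟨_, hπ.isBarycenter_map hd hw hc.measurable hμ (hT π inferInstance) hTb⟩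

end Main

end WassersteinBarycenter

theorem mainTheorem8 {X : Type*} [TopologicalSpace X] [PolishSpace X]
    [MeasurableSpace X] [BorelSpace X] (d : X → X → ℝ≥0∞)
    (hd : WassersteinBarycenter.IsExtendedMetricTopological d)
    (hc : WassersteinBarycenter.IsTopologyOf d ∨
      ∀ (n : ℕ) (w : Fin n → ℝ), WassersteinBarycenter.IsWeight w →
        LowerSemicontinuous (WassersteinBarycenter.multiCost d w))
    [mP : MeasurableSpace (ProbabilityMeasure X)]
    [MeasurableSingletonClass (ProbabilityMeasure X)] :
    (WassersteinBarycenter.IsBarycenterSpace d →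
      WassersteinBarycenter.IsBarycenterSpace (WassersteinBarycenter.W₂ d)) ∧
    (WassersteinBarycenter.IsUniformBarycenterSpace d →
      WassersteinBarycenter.IsUniformBarycenterSpace (WassersteinBarycenter.W₂ d)) ∧
    (∀ (n : ℕ) (w : Fin n → ℝ), WassersteinBarycenter.IsWeight w →
      (∀ x : Fin n → X,
        WassersteinBarycenter.variance d (WassersteinBarycenter.discreteMeasure w x) < ∞ →
          ∃ b, WassersteinBarycenter.IsBarycenter d
            (WassersteinBarycenter.discreteMeasure w x) b) →
      (∃ T : (Fin n → X) → X, WassersteinBarycenter.UniversallyMeasurable T ∧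
        WassersteinBarycenter.IsBarycenterSelection d w T) ∧
      ∀ μ : Fin n → ProbabilityMeasure X,
        WassersteinBarycenter.variance (WassersteinBarycenter.W₂ d)
          (WassersteinBarycenter.discreteMeasure w μ) < ∞ →
        (∃ π, WassersteinBarycenter.IsOptimalMultiPlan d w μ π) ∧
        ∀ (T : (Fin n → X) → X) (π : ProbabilityMeasure (Fin n → X))
          (hT : AEMeasurable T (π : Measure (Fin n → X))),
          WassersteinBarycenter.IsBarycenterSelection d w T →
          WassersteinBarycenter.IsOptimalMultiPlan d w μ π →
          WassersteinBarycenter.IsBarycenter (WassersteinBarycenter.W₂ d)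
            (WassersteinBarycenter.discreteMeasure w μ) (π.map hT)) := by
  have hlsc : ∀ (n : ℕ) (w : Fin n → ℝ), WassersteinBarycenter.IsWeight w →
      LowerSemicontinuous (WassersteinBarycenter.multiCost d w) := fun n w hw =>
    hc.elim (fun h =>
      WassersteinBarycenter.lowerSemicontinuous_multiCost hd.isExtendedMetric h hw) fun h => h n w hw
  -- The first two claims use barycenters on `X` only for the weights of the given measure on
  -- `ProbabilityMeasure X`; the points `xᵢ` may coincide.
  refine ⟨fun hb Ω _ hΩ hvar => ?_, fun hb n hn μ hvar => ?_, fun n w hw hb => ⟨?_, fun μ hμ => ?_⟩⟩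
  · obtain ⟨n, w, μ, hw, rfl⟩ := WassersteinBarycenter.exists_eq_discreteMeasure Ω hΩ
    exact WassersteinBarycenter.exists_wassersteinBarycenter hd hw (hlsc n w hw)
      (fun x hx => hb _ (WassersteinBarycenter.isProbabilityMeasure_discreteMeasure hw x)
        (WassersteinBarycenter.isFinitelySupported_discreteMeasure w x) hx) hvar
  · have hw : WassersteinBarycenter.IsWeight fun _ : Fin n => 1 / (n : ℝ) := by
      refine ⟨fun _ => by positivity, ?_⟩
      have : (n : ℝ) ≠ 0 := by positivity
      simp [this]
    exact WassersteinBarycenter.exists_wassersteinBarycenter hd hw (hlsc n _ hw) (hb n hn) hvar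
  · exact WassersteinBarycenter.exists_barycenterSelection hd hw (hlsc n w hw).measurable hb
  · exact ⟨WassersteinBarycenter.exists_isOptimalMultiPlan (hlsc n w hw) μ, fun T π hT hTb hπ =>
      hπ.isBarycenter_map hd hw (hlsc n w hw).measurable hμ hT hTb⟩
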